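/- Let $X$ be a locally compact metrizable space, let $\phi:X\to X$ be a homeomorphism, and for $f\in C_0(X)$ (complex-valued) and $n\in\mathbb Z_+=\{0,1,2,\dots\}$ put $\alpha_n(f)=f\circ\phi^n$. Fix a faithful $*$-representation of $C_0(X)$ on a Hilbert space $\mathcal H_0$. Let $\pi$ be the representation of the Banach algebra $\ell^1(\mathbb Z_+,C_0(X))$, whose elements are written $\sum_n U^nf_n$ and whose product is determined by $U^nf\,U^mg=U^{n+m}(\alpha_m(f)g)$, on $\mathcal H_0\otimes\ell^2(\mathbb Z_+)$ given by $$\pi(U^nf)(\xi\otimes e_k)=\alpha_k(f)\xi\otimes e_{k+n}.$$ The semicrossed product $\mathcal A=C_0(X)\times_\phi\mathbb Z_+$ is the operator-norm closure of the image of $\pi$. For $m\in\mathbb Z_+$, the Fourier coefficient map $E_m:\mathcal A\to C_0(X)$ is the contractive linear extension by continuity of $\pi\big(\sum_n U^nf_n\big)\mapsto f_m$. An element $A\in\mathcal A$ is called compact if the map $\mathcal A\to\mathcal A$, $T\mapsto ATA$, is a compact operator. Let $X_a$ be the set of accumulation (i.e. non-isolated) points of $X$, and let $X_r$ be the set of recurrent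 points, i.e. of those $x\in X$ for which there is a strictly increasing sequence $(n_k)$ of natural numbers with $\phi^{n_k}(x)\to x$. Let $A\in\mathcal A$ and let $f_m=E_m(A)\in C_0(X)$ for all $m\in\mathbb Z_+$. Then $A$ is a compact element of $\mathcal A$ if and only if the following conditions hold for all $m,n\in\mathbb Z_+$: 1. $\big((f_m\circ\phi^{n+l})\,f_n\big)(x)=0$ for all $l\in\mathbb Z_+$ and all $x\in X_a$; 2. $f_m(x)=0$ for all $x\in X_r$; 3. the sequence of functions $\{(f_m\circ\phi^{n+l})\,f_n\}_{l\in\mathbb Z_+}$ is equicontinuous at every point of $X$. -/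

import Mathlib

open Filter Topology
open scoped ZeroAtInfty lp ENNReal

noncomputable section

set_option linter.unusedSectionVars false

namespace Semicrossed

section Dynamics

variable {X : Type*} [TopologicalSpace X]

/-- The action of `ℕ` on `C₀(X)` given by a homeomorphism `φ` of `X`: `α n f = f ∘ φⁿ`. -/
def α (φ : X ≃ₜ X) (n : ℕ) (f : C₀(X, ℂ)) : C₀(X, ℂ) where
  toFun x := f (φ^[n] x)
  continuous_toFun := f.continuous.comp (φ.continuous.iterate n)
  zero_at_infty' := by
    have h : Tendsto (φ^[n]) (cocompact X) (cocompact X) := by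
      induction n with
      | zero => exact tendsto_id
      | succ k ih => exact ih.comp φ.isClosedEmbedding.tendsto_cocompact
    exact (zero_at_infty f).comp h

@[simp]
theorem α_apply (φ : X ≃ₜ X) (n : ℕ) (f : C₀(X, ℂ)) (x : X) : α φ n f x = f (φ^[n] x) := rfl

theorem norm_α_le (φ : X ≃ₜ X) (n : ℕ) (f : C₀(X, ℂ)) : ‖α φ n f‖ ≤ ‖f‖ := by
  rw [← ZeroAtInftyContinuousMap.norm_toBCF_eq_norm (f := α φ n f),
    BoundedContinuousFunction.norm_le (norm_nonneg _)]
  intro x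
  rw [← ZeroAtInftyContinuousMap.norm_toBCF_eq_norm (f := f)]
  exact f.toBCF.norm_coe_le_norm (φ^[n] x)

/-- The set `X_a` of accumulation (that is, non-isolated) points of `X`. -/
def accumulationPoints (X : Type*) [TopologicalSpace X] : Set X := derivedSet Set.univ

/-- The set `X_r` of recurrent points of the dynamical system `(X, φ)`: the points `x` for which
`φ^{n_k}(x) → x` along some strictly increasing sequence `(n_k)` of natural numbers. -/
def recurrentPoints (φ : X ≃ₜ X) : Set X :=
  {x | ∃ u : ℕ → ℕ, StrictMono u ∧ Tendsto (fun k => φ^[u k] x) atTop (𝓝 x)}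

end Dynamics

/-- An element `a` of a normed algebra is compact if the map `x ↦ a x a` is compact. -/
def IsCompactElement {A : Type*} [NonUnitalNormedRing A] (a : A) : Prop :=
  IsCompactOperator fun x : A => a * x * a

section Construction

variable {X : Type*} [TopologicalSpace X] (φ : X ≃ₜ X)
  {H₀ : Type*} [NormedAddCommGroup H₀] [InnerProductSpace ℂ H₀] [CompleteSpace H₀]
  (ρ : C₀(X, ℂ) →⋆ₙₐ[ℂ] (H₀ →L[ℂ] H₀))

/-- The Hilbert space `H₀ ⊗ ℓ²(ℕ)`, realised as the space `ℓ²(ℕ, H₀)` of square summable sequences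
in `H₀`; the elementary tensor `ξ ⊗ e_k` is `lp.single 2 k ξ`. -/
abbrev TensorL2 (H₀ : Type*) [NormedAddCommGroup H₀] : Type _ := lp (fun _ : ℕ => H₀) 2

/-- The sequence `π(Uⁿ f) ξ`, coordinatewise. -/
def monomialFun (n : ℕ) (f : C₀(X, ℂ)) (ξ : ℕ → H₀) (k : ℕ) : H₀ :=
  if n ≤ k then ρ (α φ (k - n) f) (ξ (k - n)) else 0

theorem hasSum_monomialFun_bound (n : ℕ) (f : C₀(X, ℂ)) (ξ : TensorL2 H₀) :
    HasSum (fun k => if n ≤ k then (‖f‖ * ‖ξ (k - n)‖) ^ 2 else 0) ((‖f‖ * ‖ξ‖) ^ 2) := by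
  have h : HasSum (fun k => (‖f‖ * ‖ξ k‖) ^ 2) ((‖f‖ * ‖ξ‖) ^ 2) := by
    have := (lp.hasSum_norm (p := 2) (by simp) ξ).mul_left (‖f‖ ^ 2)
    simpa [mul_pow] using this
  refine ((add_left_injective n).hasSum_iff ?_).1 ?_
  · intro k hk
    rw [if_neg]
    intro hn
    exact hk ⟨k - n, by simp [hn]⟩
  · simpa [Function.comp_def] using h

theorem norm_monomialFun_sq_le (n : ℕ) (f : C₀(X, ℂ)) (ξ : ℕ → H₀) (k : ℕ) :
    ‖monomialFun φ ρ n f ξ k‖ ^ 2 ≤ if n ≤ k then (‖f‖ * ‖ξ (k - n)‖) ^ 2 else 0 := by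
  unfold monomialFun
  split_ifs
  · gcongr
    refine (ContinuousLinearMap.le_opNorm _ _).trans ?_
    gcongr
    exact (NonUnitalStarAlgHom.norm_apply_le ρ _).trans (norm_α_le φ _ f)
  · simp

theorem memℓp_monomialFun (n : ℕ) (f : C₀(X, ℂ)) (ξ : TensorL2 H₀) :
    Memℓp (monomialFun φ ρ n f ξ) 2 := by
  refine memℓp_gen ?_
  refine Summable.of_nonneg_of_le (fun k => by positivity) (fun k => ?_)
    (hasSum_monomialFun_bound n f ξ).summable
  simpa using norm_monomialFun_sq_le φ ρ n f ξ k

/-- The operator `π(Uⁿ f)` on `H₀ ⊗ ℓ²(ℕ)`, see `monomial_single`. -/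
def monomial (n : ℕ) (f : C₀(X, ℂ)) : TensorL2 H₀ →L[ℂ] TensorL2 H₀ :=
  LinearMap.mkContinuous
    { toFun ξ := ⟨monomialFun φ ρ n f ξ, memℓp_monomialFun φ ρ n f ξ⟩
      map_add' ξ η := by
        ext k
        simp only [monomialFun, lp.coeFn_add, Pi.add_apply]
        split_ifs <;> simp
      map_smul' c ξ := by
        ext k
        simp only [monomialFun, lp.coeFn_smul, Pi.smul_apply, RingHom.id_apply]
        split_ifs <;> simp }
    ‖f‖ fun ξ => by
      refine lp.norm_le_of_tsum_le (by simp) (by positivity) ?_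
      have h := hasSum_monomialFun_bound n f ξ
      have hm := (memℓp_monomialFun φ ρ n f ξ).summable (by simp)
      have := hm.tsum_le_tsum (fun k => by simpa using norm_monomialFun_sq_le φ ρ n f ξ k)
        h.summable
      rw [h.tsum_eq] at this
      simpa using this

theorem monomial_apply (n : ℕ) (f : C₀(X, ℂ)) (ξ : TensorL2 H₀) (k : ℕ) :
    monomial φ ρ n f ξ k = if n ≤ k then ρ (α φ (k - n) f) (ξ (k - n)) else 0 := rfl

/-- `π(Uⁿ f) (ξ ⊗ e_k) = α_k(f) ξ ⊗ e_{k+n}`. -/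
theorem monomial_single (n : ℕ) (f : C₀(X, ℂ)) (k : ℕ) (ξ : H₀) :
    monomial φ ρ n f (lp.single 2 k ξ) = lp.single 2 (k + n) (ρ (α φ k f) ξ) := by
  ext j
  rw [monomial_apply]
  rcases eq_or_ne j (k + n) with rfl | hj
  · simp
  · rw [lp.single_apply_ne _ _ _ hj]
    split_ifs with h
    · rw [lp.single_apply_ne _ _ _ (by omega), map_zero]
    · rfl

theorem norm_monomial_le (n : ℕ) (f : C₀(X, ℂ)) : ‖monomial φ ρ n f‖ ≤ ‖f‖ :=
  LinearMap.mkContinuous_norm_le _ (norm_nonneg f) _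

theorem monomial_add (n : ℕ) (f g : C₀(X, ℂ)) :
    monomial φ ρ n (f + g) = monomial φ ρ n f + monomial φ ρ n g := by
  ext ξ k
  have : α φ (k - n) (f + g) = α φ (k - n) f + α φ (k - n) g := rfl
  simp only [monomial_apply, add_apply, lp.coeFn_add, Pi.add_apply, this]
  split_ifs <;> simp

theorem monomial_smul (n : ℕ) (c : ℂ) (f : C₀(X, ℂ)) :
    monomial φ ρ n (c • f) = c • monomial φ ρ n f := by
  ext ξ k
  have : α φ (k - n) (c • f) = c • α φ (k - n) f := rfl
  simp only [monomial_apply, smul_apply, lp.coeFn_smul, Pi.smul_apply, this]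
  split_ifs <;> simp

/-- The multiplication rule `Uⁿ f Uᵐ g = Uⁿ⁺ᵐ (α_m(f) g)`. -/
theorem monomial_mul_monomial (n m : ℕ) (f g : C₀(X, ℂ)) :
    monomial φ ρ n f * monomial φ ρ m g = monomial φ ρ (n + m) (α φ m f * g) := by
  ext ξ k
  simp only [mul_apply_eq_comp, monomial_apply]
  by_cases h : n + m ≤ k
  · have h1 : n ≤ k := by omega
    have h2 : m ≤ k - n := by omega
    have h3 : k - n - m = k - (n + m) := by omega
    have h4 : α φ (k - (n + m)) (α φ m f * g) = α φ (k - n) f * α φ (k - (n + m)) g := by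
      ext x
      have h5 : m + (k - (n + m)) = k - n := by omega
      simp only [α_apply, ZeroAtInftyContinuousMap.coe_mul, Pi.mul_apply]
      rw [← Function.iterate_add_apply, h5]
    simp [h, h1, h2, h3, h4]
  · by_cases h1 : n ≤ k
    · have h2 : ¬ m ≤ k - n := by omega
      simp [h, h1, h2]
    · simp [h, h1]

theorem summable_monomial (F : ℓ^1(ℕ, C₀(X, ℂ))) : Summable fun n => monomial φ ρ n (F n) := by
  refine Summable.of_norm_bounded (g := fun n => ‖F n‖) ?_ fun n => norm_monomial_le φ ρ n (F n)
  simpa using (lp.memℓp F).summable (by simp)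

/-- The representation `π(∑ Uⁿ fₙ) = ∑ π(Uⁿ fₙ)` of `ℓ¹(ℕ, C₀(X))` on `H₀ ⊗ ℓ²(ℕ)`, as a
linear map. -/
def π : ℓ^1(ℕ, C₀(X, ℂ)) →ₗ[ℂ] (TensorL2 H₀ →L[ℂ] TensorL2 H₀) where
  toFun F := ∑' n, monomial φ ρ n (F n)
  map_add' F G := by
    simp only [lp.coeFn_add, Pi.add_apply, monomial_add]
    exact (summable_monomial φ ρ F).tsum_add (summable_monomial φ ρ G)
  map_smul' c F := by
    simp only [lp.coeFn_smul, Pi.smul_apply, monomial_smul, RingHom.id_apply]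
    exact (summable_monomial φ ρ F).tsum_const_smul c

theorem hasSum_π (F : ℓ^1(ℕ, C₀(X, ℂ))) : HasSum (fun n => monomial φ ρ n (F n)) (π φ ρ F) :=
  (summable_monomial φ ρ F).hasSum

theorem π_single (n : ℕ) (f : C₀(X, ℂ)) : π φ ρ (lp.single 1 n f) = monomial φ ρ n f := by
  have h0 : ∀ m, monomial φ ρ m 0 = 0 := fun m => by
    simpa using monomial_smul φ ρ m 0 0
  have h := hasSum_single (f := fun m => monomial φ ρ m ((lp.single 1 n f : ℓ^1(ℕ, C₀(X, ℂ))) m)) n fun m hm => by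
    rw [lp.single_apply_ne _ _ _ hm, h0]
  simpa using (hasSum_π φ ρ _).unique h

theorem monomial_mem_range (n : ℕ) (f : C₀(X, ℂ)) : monomial φ ρ n f ∈ LinearMap.range (π φ ρ) :=
  ⟨_, π_single φ ρ n f⟩

theorem π_mul_π_mem (F G : ℓ^1(ℕ, C₀(X, ℂ))) :
    π φ ρ F * π φ ρ G ∈ closure (LinearMap.range (π φ ρ) : Set (TensorL2 H₀ →L[ℂ] TensorL2 H₀)) := by
  have h : Tendsto (fun s : Finset ℕ =>
      (∑ n ∈ s, monomial φ ρ n (F n)) * ∑ n ∈ s, monomial φ ρ n (G n)) atTop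
      (𝓝 (π φ ρ F * π φ ρ G)) := Tendsto.mul (hasSum_π φ ρ F) (hasSum_π φ ρ G)
  refine mem_closure_of_tendsto h (Eventually.of_forall fun s => ?_)
  rw [Finset.sum_mul_sum]
  refine Submodule.sum_mem _ fun i _ => Submodule.sum_mem _ fun j _ => ?_
  rw [monomial_mul_monomial]
  exact monomial_mem_range φ ρ _ _

/-- The semicrossed product `C₀(X) ×_φ ℤ₊`: the norm closure of `π(ℓ¹(ℕ, C₀(X)))` in the algebra of
bounded operators on `H₀ ⊗ ℓ²(ℕ)`. -/
def product : NonUnitalSubalgebra ℂ (TensorL2 H₀ →L[ℂ] TensorL2 H₀) where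
  __ := (LinearMap.range (π φ ρ)).topologicalClosure
  mul_mem' {a b} ha hb := by
    have := map_mem_closure₂ (u := closure (LinearMap.range (π φ ρ) : Set _)) continuous_mul ha hb
      (by rintro _ ⟨F, rfl⟩ _ ⟨G, rfl⟩; exact π_mul_π_mem φ ρ F G)
    rwa [closure_closure] at this

theorem π_mem (F : ℓ^1(ℕ, C₀(X, ℂ))) : π φ ρ F ∈ product φ ρ :=
  subset_closure ⟨F, rfl⟩

/-- A faithful representation of `C₀(X)`, as a linear isometry. -/
def repIsometry (hρ : Function.Injective ρ) : C₀(X, ℂ) →ₗᵢ[ℂ] (H₀ →L[ℂ] H₀) where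
  toFun := ρ
  map_add' := map_add ρ
  map_smul' := map_smul ρ
  norm_map' := NonUnitalStarAlgHom.norm_map ρ hρ

/-- The `(n, 0)` entry `H₀ → H₀` of the operator matrix of `T`. -/
def entry (n : ℕ) : (TensorL2 H₀ →L[ℂ] TensorL2 H₀) →L[ℂ] (H₀ →L[ℂ] H₀) :=
  (ContinuousLinearMap.compL ℂ H₀ (TensorL2 H₀) H₀ (lp.evalCLM ℂ (fun _ : ℕ => H₀) 2 n)).comp
    ((ContinuousLinearMap.compL ℂ H₀ (TensorL2 H₀) (TensorL2 H₀)).flip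
      (lp.singleContinuousLinearMap ℂ (fun _ : ℕ => H₀) 2 0))

theorem entry_apply (n : ℕ) (T : TensorL2 H₀ →L[ℂ] TensorL2 H₀) (ξ : H₀) :
    entry n T ξ = T (lp.single 2 0 ξ) n := rfl

theorem entry_monomial (n m : ℕ) (f : C₀(X, ℂ)) :
    entry n (monomial φ ρ m f) = if m = n then ρ f else 0 := by
  ext ξ
  rw [entry_apply, monomial_single]
  have h : α φ 0 f = f := rfl
  split_ifs with hm
  · subst hm
    simp [h]
  · rw [lp.single_apply_ne _ _ _ (by omega)]
    rfl

theorem entry_π (n : ℕ) (F : ℓ^1(ℕ, C₀(X, ℂ))) : entry n (π φ ρ F) = ρ (F n) := by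
  have h1 := (hasSum_π φ ρ F).mapL (entry n)
  have h2 := hasSum_single (f := fun m => entry n (monomial φ ρ m (F m))) n fun m hm => by
    rw [entry_monomial, if_neg hm]
  rw [h1.unique h2, entry_monomial, if_pos rfl]

theorem entry_mem (hρ : Function.Injective ρ) (n : ℕ) {T : TensorL2 H₀ →L[ℂ] TensorL2 H₀}
    (hT : T ∈ product φ ρ) :
    entry n T ∈ LinearMap.range (repIsometry ρ hρ).toLinearMap := by
  have hc : IsClosed (Set.range (repIsometry ρ hρ)) :=
    (repIsometry ρ hρ).isometry.isClosedEmbedding.isClosed_range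
  have := map_mem_closure (t := Set.range (repIsometry ρ hρ)) (entry n).continuous hT (by
    rintro _ ⟨F, rfl⟩
    exact ⟨F n, (entry_π φ ρ n F).symm⟩)
  rw [hc.closure_eq] at this
  exact this

/-- The `n`-th Fourier coefficient `Eₙ : A → C₀(X)` on the semicrossed product. It is the
continuous extension of `∑ Uⁿ fₙ ↦ fₙ`, see `fourierCoeff_π` and `norm_fourierCoeff_le`; it is
obtained from the identity `ρ (Eₙ T) ξ = (T (ξ ⊗ e₀))ₙ`. -/
def fourierCoeff (hρ : Function.Injective ρ) (n : ℕ) : product φ ρ →L[ℂ] C₀(X, ℂ) :=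
  ((repIsometry ρ hρ).equivRange.symm.toContinuousLinearEquiv :
      LinearMap.range (repIsometry ρ hρ).toLinearMap →L[ℂ] C₀(X, ℂ)).comp
    (ContinuousLinearMap.codRestrict
      ((entry n).comp (product φ ρ).toSubmodule.subtypeL)
      (LinearMap.range (repIsometry ρ hρ).toLinearMap)
      fun T => entry_mem φ ρ hρ n T.2)

theorem ρ_fourierCoeff (hρ : Function.Injective ρ) (n : ℕ) (T : product φ ρ) :
    ρ (fourierCoeff φ ρ hρ n T) = entry n (T : TensorL2 H₀ →L[ℂ] TensorL2 H₀) := by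
  have := (repIsometry ρ hρ).equivRange.apply_symm_apply ⟨_, entry_mem φ ρ hρ n T.2⟩
  exact congrArg Subtype.val this

theorem fourierCoeff_π (hρ : Function.Injective ρ) (n : ℕ) (F : ℓ^1(ℕ, C₀(X, ℂ))) :
    fourierCoeff φ ρ hρ n ⟨π φ ρ F, π_mem φ ρ F⟩ = F n :=
  hρ (by rw [ρ_fourierCoeff, entry_π])

theorem norm_fourierCoeff_le (hρ : Function.Injective ρ) (n : ℕ) (T : product φ ρ) :
    ‖fourierCoeff φ ρ hρ n T‖ ≤ ‖T‖ := by
  rw [← NonUnitalStarAlgHom.norm_map ρ hρ, ρ_fourierCoeff]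
  refine ContinuousLinearMap.opNorm_le_bound _ (norm_nonneg _) fun ξ => ?_
  rw [entry_apply]
  refine (lp.norm_apply_le_norm (by simp) _ n).trans ?_
  refine (ContinuousLinearMap.le_opNorm _ _).trans ?_
  rw [lp.norm_single (by simp)]
  rfl

end Construction

end Semicrossed

end

open Filter Topology
open scoped ZeroAtInfty lp ENNReal

noncomputable section

set_option linter.unusedSectionVars false
set_option synthInstance.maxHeartbeats 200000

namespace Semicrossed

/-! ### Generators, Fourier coefficients and their decay -/

section Algebra

variable {X : Type*} [TopologicalSpace X] (φ : X ≃ₜ X)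
  {H₀ : Type*} [NormedAddCommGroup H₀] [InnerProductSpace ℂ H₀] [CompleteSpace H₀]
  (ρ : C₀(X, ℂ) →⋆ₙₐ[ℂ] (H₀ →L[ℂ] H₀))

/-! Write `f_m` for the Fourier coefficients of `A`. Both directions rest on one computation,
`fourierCoeff_mul_generator_mul`: at `x`, the coefficient of index `d + l` of `A Uˡg A` is the sum
over `i + j = d` of `f_i(φ^{j+l} x) g(φ^j x) f_j(x)`.

Necessity. If `A` is compact, all `A Uˡg A` with `‖g‖ ≤ 1` lie in one compact set, on which Fourier
coefficients decay uniformly and are equicontinuous uniformly in the index. A bump `g` at `φⁿ x`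
that kills the other points of a finite orbit segment isolates `f_m(φ^{n+l} x) f_n(x)`. Decay forces
`f_m = 0` at recurrent points, by induction on `m`. Other points have injective forward orbits, and
there equicontinuity gives conditions 1 and 3.

Sufficiency. By Fejér's theorem (`tendsto_cesaroMean`) it is enough that each `T ↦ Uᵐf_m T Uⁿf_n` is
compact. On `Uˡg` this map multiplies `g ∘ φⁿ` by `(f_m ∘ φ^{n+l}) f_n`. The points where both
factors exceed `ε` for some `l` are finite in number, by 1 and 3 (`finite_setOf_lt_norm`), and only
finitely many `l` occur because `f_m` tends to 0 along every forward orbit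
(`eventually_norm_iterate_le`). Truncating at level `ε` therefore gives finite-rank maps, which
converge in norm. -/

instance product.instNormedSpace : NormedSpace ℂ (product φ ρ) where
  norm_smul_le c T := norm_smul_le c (T : TensorL2 H₀ →L[ℂ] TensorL2 H₀)

theorem isClosed_product : IsClosed (product φ ρ : Set (TensorL2 H₀ →L[ℂ] TensorL2 H₀)) :=
  (LinearMap.range (π φ ρ)).isClosed_topologicalClosure

instance product.instCompleteSpace : CompleteSpace (product φ ρ) :=
  (isClosed_product φ ρ).completeSpace_coe

/-- The generator `Uⁿ f` of the semicrossed product, linear in `f`. -/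
def generator (n : ℕ) : C₀(X, ℂ) →ₗ[ℂ] product φ ρ where
  toFun f := ⟨monomial φ ρ n f, subset_closure (monomial_mem_range φ ρ n f)⟩
  map_add' f g := Subtype.ext (monomial_add φ ρ n f g)
  map_smul' c f := Subtype.ext (monomial_smul φ ρ n c f)

@[simp]
theorem coe_generator (n : ℕ) (f : C₀(X, ℂ)) :
    (generator φ ρ n f : TensorL2 H₀ →L[ℂ] TensorL2 H₀) = monomial φ ρ n f := rfl

theorem norm_generator_le (n : ℕ) (f : C₀(X, ℂ)) : ‖generator φ ρ n f‖ ≤ ‖f‖ :=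
  norm_monomial_le φ ρ n f

theorem continuous_generator (n : ℕ) : Continuous (generator φ ρ n) :=
  AddMonoidHomClass.continuous_of_bound (generator φ ρ n) 1 fun f =>
    (norm_generator_le φ ρ n f).trans_eq (one_mul _).symm

theorem generator_mul_generator (n m : ℕ) (f g : C₀(X, ℂ)) :
    generator φ ρ n f * generator φ ρ m g = generator φ ρ (n + m) (α φ m f * g) :=
  Subtype.ext (monomial_mul_monomial φ ρ n m f g)

/-- The semicrossed product is topologically spanned by the finite sums `∑_{n < N} Uⁿ fₙ`. -/
theorem product_induction_sum {p : product φ ρ → Prop} (hp : IsClosed {T | p T})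
    (hsum : ∀ (N : ℕ) (F : ℕ → C₀(X, ℂ)), p (∑ n ∈ Finset.range N, generator φ ρ n (F n)))
    (T : product φ ρ) : p T := by
  have hπ (F : ℓ^1(ℕ, C₀(X, ℂ))) : p ⟨π φ ρ F, π_mem φ ρ F⟩ := by
    have h := (hasSum_π φ ρ F).tendsto_sum_nat
    have h' : Tendsto (fun N => ∑ n ∈ Finset.range N, generator φ ρ n (F n)) atTop
        (𝓝 (⟨π φ ρ F, π_mem φ ρ F⟩ : product φ ρ)) := by
      rw [tendsto_subtype_rng]
      convert h using 2
      simp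
    exact hp.mem_of_tendsto h' (Eventually.of_forall fun N => hsum N F)
  obtain ⟨u, hu, hlim⟩ := mem_closure_iff_seq_limit.1
    (show (T : TensorL2 H₀ →L[ℂ] TensorL2 H₀) ∈
      closure (LinearMap.range (π φ ρ) : Set (TensorL2 H₀ →L[ℂ] TensorL2 H₀)) from T.2)
  choose F hF using hu
  have h : Tendsto (fun k => (⟨π φ ρ (F k), π_mem φ ρ (F k)⟩ : product φ ρ)) atTop (𝓝 T) := by
    rw [tendsto_subtype_rng]
    simpa [hF] using hlim
  exact hp.mem_of_tendsto h (Eventually.of_forall fun k => hπ _)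

theorem product_induction {p : product φ ρ → Prop} (hp : IsClosed {T | p T})
    (hgen : ∀ n f, p (generator φ ρ n f)) (hadd : ∀ S T, p S → p T → p (S + T))
    (T : product φ ρ) : p T := by
  refine product_induction_sum φ ρ hp (fun N F => ?_) T
  induction N with
  | zero => simpa using hgen 0 0
  | succ N ih => rw [Finset.sum_range_succ]; exact hadd _ _ ih (hgen _ _)

variable (hρ : Function.Injective ρ)

theorem fourierCoeff_generator (n m : ℕ) (f : C₀(X, ℂ)) :
    fourierCoeff φ ρ hρ n (generator φ ρ m f) = if m = n then f else 0 := by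
  refine hρ ?_
  rw [ρ_fourierCoeff, coe_generator, entry_monomial]
  split_ifs <;> simp

/-- Evaluation of an element of `C₀(X)` at a point, as a continuous linear functional. -/
def evalCLM (x : X) : C₀(X, ℂ) →L[ℂ] ℂ :=
  LinearMap.mkContinuous
    { toFun f := f x
      map_add' _ _ := rfl
      map_smul' _ _ := rfl } 1 fun f => by
    rw [one_mul, ← ZeroAtInftyContinuousMap.norm_toBCF_eq_norm (f := f)]
    exact f.toBCF.norm_coe_le_norm x

theorem norm_apply_le (f : C₀(X, ℂ)) (x : X) : ‖f x‖ ≤ ‖f‖ := by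
  rw [← ZeroAtInftyContinuousMap.norm_toBCF_eq_norm (f := f)]
  exact f.toBCF.norm_coe_le_norm x

theorem norm_le_of_forall_apply_le {f : C₀(X, ℂ)} {C : ℝ} (hC : 0 ≤ C) (h : ∀ x, ‖f x‖ ≤ C) :
    ‖f‖ ≤ C := by
  rw [← ZeroAtInftyContinuousMap.norm_toBCF_eq_norm (f := f), BoundedContinuousFunction.norm_le hC]
  exact h

theorem continuous_fourierCoeff_apply (n : ℕ) (x : X) :
    Continuous fun T : product φ ρ => fourierCoeff φ ρ hρ n T x :=
  (evalCLM x).continuous.comp (fourierCoeff φ ρ hρ n).continuous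

/-- The Fourier coefficients of `S Uˡg T`. -/
theorem fourierCoeff_mul_generator_mul (l d : ℕ) (g : C₀(X, ℂ)) (S T : product φ ρ) (x : X) :
    fourierCoeff φ ρ hρ (d + l) (S * generator φ ρ l g * T) x =
      ∑ p ∈ Finset.HasAntidiagonal.antidiagonal d, fourierCoeff φ ρ hρ p.1 S (φ^[p.2 + l] x) *
        g (φ^[p.2] x) * fourierCoeff φ ρ hρ p.2 T x := by
  have hc := continuous_fourierCoeff_apply φ ρ hρ
  revert S
  refine product_induction φ ρ ?_ ?_ ?_
  · refine isClosed_eq ((hc _ _).comp (by fun_prop)) ?_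
    exact continuous_finsetSum _ fun p _ => ((hc _ _).mul continuous_const).mul continuous_const
  · intro m f
    revert T
    refine product_induction φ ρ ?_ ?_ ?_
    · refine isClosed_eq ((hc _ _).comp (by fun_prop)) ?_
      exact continuous_finsetSum _ fun p _ => continuous_const.mul (hc _ _)
    · intro n h
      simp only [generator_mul_generator, fourierCoeff_generator]
      by_cases hd : m + n = d
      · rw [if_pos (by omega), Finset.sum_eq_single (m, n)]
        · simp [Function.iterate_add_apply, Nat.add_comm n l]
        · rintro ⟨i, j⟩ - hij
          by_cases hi : m = i
          · have hj : ¬ n = j := fun hj => hij (by rw [hi, hj])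
            simp [hj]
          · simp [hi]
        · simp [hd]
      · rw [if_neg (by omega), Finset.sum_eq_zero]
        · rfl
        · rintro ⟨i, j⟩ hij
          rw [Finset.HasAntidiagonal.mem_antidiagonal] at hij
          by_cases hi : m = i
          · have hj : ¬ n = j := by rintro rfl; subst hi; exact hd hij
            simp [hj]
          · simp [hi]
    · intro S T hS hT
      simp only [mul_add, map_add, ZeroAtInftyContinuousMap.add_apply, hS, hT,
        Finset.sum_add_distrib]
  · intro S S' hS hS'
    simp only [add_mul, map_add, ZeroAtInftyContinuousMap.add_apply, hS, hS',
      Finset.sum_add_distrib]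

/-- A Riemann–Lebesgue lemma: on a generator the coefficients are eventually zero, and contractivity
of the coefficient maps, uniform in `n`, carries the decay to the closure. -/
theorem tendsto_fourierCoeff (T : product φ ρ) :
    Tendsto (fun n => fourierCoeff φ ρ hρ n T) atTop (𝓝 0) := by
  rw [NormedAddGroup.tendsto_nhds_zero]
  revert T
  refine product_induction φ ρ ?_ ?_ ?_
  · rw [← closure_subset_iff_isClosed]
    intro T hT ε hε
    obtain ⟨S, hS, hST⟩ := Metric.mem_closure_iff.1 hT (ε / 2) (half_pos hε)
    filter_upwards [hS (ε / 2) (half_pos hε)] with n hn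
    have h := norm_fourierCoeff_le φ ρ hρ n (T - S)
    rw [dist_eq_norm] at hST
    have h2 := norm_add_le (fourierCoeff φ ρ hρ n (T - S)) (fourierCoeff φ ρ hρ n S)
    rw [← map_add, sub_add_cancel] at h2
    exact (h2.trans_lt (add_lt_add (h.trans_lt hST) hn)).trans_eq (add_halves ε)
  · intro m f ε hε
    filter_upwards [eventually_gt_atTop m] with n hn
    rw [fourierCoeff_generator, if_neg hn.ne]
    simpa using hε
  · intro S T hS hT ε hε
    filter_upwards [hS (ε / 2) (half_pos hε), hT (ε / 2) (half_pos hε)] with n h1 h2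
    rw [map_add]
    exact (norm_add_le _ _).trans_lt (by linarith)

end Algebra

/-! ### Bump functions -/

section Urysohn

variable {X : Type*} [TopologicalSpace X] [LocallyCompactSpace X] [T2Space X]

/-- A bump function in `C₀(X)` at a point `y`, vanishing on a finite set not containing `y`. -/
theorem exists_bump (y : X) {s : Set X} (hs : s.Finite) (hy : y ∉ s) :
    ∃ g : C₀(X, ℂ), ‖g‖ ≤ 1 ∧ (∀ᶠ z in 𝓝 y, g z = 1) ∧ ∀ x ∈ s, ∀ᶠ z in 𝓝 x, g z = 0 := by
  obtain ⟨U, V, hU, hV, hyU, hsV, hUV⟩ :=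
    SeparatedNhds.of_isCompact_isCompact (isCompact_singleton (x := y)) hs.isCompact
      (Set.disjoint_singleton_left.2 hy)
  obtain ⟨K, hK, hyK, hKU⟩ := exists_compact_subset hU (hyU rfl)
  obtain ⟨f, hf1, hf0, hfc, hf⟩ := exists_continuous_one_zero_of_isCompact hK hU.isClosed_compl
    (Set.disjoint_compl_right_iff_subset.2 hKU)
  refine ⟨⟨⟨fun x => (f x : ℂ), by fun_prop⟩, ?_⟩, ?_, ?_, ?_⟩
  · have h : HasCompactSupport fun x => (f x : ℂ) :=
      hfc.comp_left (g := fun r : ℝ => (r : ℂ)) Complex.ofReal_zero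
    exact (h.is_zero_at_infty : _)
  · refine norm_le_of_forall_apply_le zero_le_one fun x => ?_
    change ‖(f x : ℂ)‖ ≤ 1
    rw [Complex.norm_real, Real.norm_of_nonneg (hf x).1]
    exact (hf x).2
  · filter_upwards [isOpen_interior.mem_nhds hyK] with z hz
    change (f z : ℂ) = 1
    simpa using hf1 (interior_subset hz)
  · intro x hx
    filter_upwards [hV.mem_nhds (hsV hx)] with z hz
    change (f z : ℂ) = 0
    simpa using hf0 (fun hzU => hUV.le_bot ⟨hzU, hz⟩)

end Urysohn

/-! ### Compactness implies the three conditions -/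

section Necessity

variable {X : Type*} [TopologicalSpace X] (φ : X ≃ₜ X)
  {H₀ : Type*} [NormedAddCommGroup H₀] [InnerProductSpace ℂ H₀] [CompleteSpace H₀]
  (ρ : C₀(X, ℂ) →⋆ₙₐ[ℂ] (H₀ →L[ℂ] H₀)) (hρ : Function.Injective ρ)

theorem norm_fourierCoeff_le_add (n : ℕ) (S T : product φ ρ) :
    ‖fourierCoeff φ ρ hρ n S‖ ≤ ‖S - T‖ + ‖fourierCoeff φ ρ hρ n T‖ := by
  have h2 := norm_add_le (fourierCoeff φ ρ hρ n (S - T)) (fourierCoeff φ ρ hρ n T)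
  rw [← map_add, sub_add_cancel] at h2
  exact h2.trans (add_le_add_left (norm_fourierCoeff_le φ ρ hρ n (S - T)) _)

/-- Fourier coefficients tend to zero uniformly on compact sets. -/
theorem eventually_norm_fourierCoeff_lt {K : Set (product φ ρ)} (hK : IsCompact K) {ε : ℝ}
    (hε : 0 < ε) : ∀ᶠ n in atTop, ∀ T ∈ K, ‖fourierCoeff φ ρ hρ n T‖ < ε := by
  refine hK.induction_on (p := fun K => ∀ᶠ n in atTop, ∀ T ∈ K, ‖fourierCoeff φ ρ hρ n T‖ < ε)
    (by simp) ?_ ?_ ?_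
  · intro s t hst ht
    filter_upwards [ht] with n hn T hT using hn T (hst hT)
  · intro s t hs ht
    filter_upwards [hs, ht] with n h1 h2 T hT using hT.elim (h1 T) (h2 T)
  · intro S _
    refine ⟨Metric.ball S (ε / 2), mem_nhdsWithin_of_mem_nhds (Metric.ball_mem_nhds _ (half_pos hε)),
      ?_⟩
    filter_upwards [NormedAddGroup.tendsto_nhds_zero.1 (tendsto_fourierCoeff φ ρ hρ S) (ε / 2)
      (half_pos hε)] with n hn T hT
    rw [mem_ball_iff_norm] at hT
    exact ((norm_fourierCoeff_le_add φ ρ hρ n T S).trans_lt (add_lt_add hT hn)).trans_eq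
      (add_halves ε)

/-- The Fourier coefficients of the elements of a compact set are equicontinuous. -/
theorem eventually_dist_fourierCoeff_lt {K : Set (product φ ρ)} (hK : IsCompact K) (x : X) {ε : ℝ}
    (hε : 0 < ε) : ∀ᶠ y in 𝓝 x, ∀ T ∈ K, ∀ n,
      ‖fourierCoeff φ ρ hρ n T y - fourierCoeff φ ρ hρ n T x‖ < ε := by
  refine hK.induction_on (p := fun K => ∀ᶠ y in 𝓝 x, ∀ T ∈ K, ∀ n,
      ‖fourierCoeff φ ρ hρ n T y - fourierCoeff φ ρ hρ n T x‖ < ε) (by simp) ?_ ?_ ?_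
  · intro s t hst ht
    filter_upwards [ht] with y hy T hT using hy T (hst hT)
  · intro s t hs ht
    filter_upwards [hs, ht] with n h1 h2 T hT using hT.elim (h1 T) (h2 T)
  · intro S _
    have h5 : 0 < ε / 5 := by positivity
    refine ⟨Metric.ball S (ε / 5), mem_nhdsWithin_of_mem_nhds (Metric.ball_mem_nhds _ h5), ?_⟩
    obtain ⟨N, hN⟩ := eventually_atTop.1 (NormedAddGroup.tendsto_nhds_zero.1
      (tendsto_fourierCoeff φ ρ hρ S) (ε / 5) h5)
    -- Continuity is needed only for the finitely many `n < N`; beyond `N` both values of the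
    -- coefficient of `S` are below `ε / 5`.
    have hfin : ∀ᶠ y in 𝓝 x, ∀ n ∈ Finset.range N,
        ‖fourierCoeff φ ρ hρ n S y - fourierCoeff φ ρ hρ n S x‖ < ε / 5 := by
      rw [Filter.eventually_all_finset]
      intro n _
      have := (fourierCoeff φ ρ hρ n S).continuous.tendsto x
      rw [tendsto_iff_norm_sub_tendsto_zero] at this
      exact this.eventually_lt_const h5
    filter_upwards [hfin] with y hy T hT n
    rw [mem_ball_iff_norm] at hT
    have hdiff (z : X) : ‖fourierCoeff φ ρ hρ n T z - fourierCoeff φ ρ hρ n S z‖ < ε / 5 := by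
      have h := (norm_apply_le (fourierCoeff φ ρ hρ n (T - S)) z).trans
        (norm_fourierCoeff_le φ ρ hρ n (T - S))
      rw [ContinuousLinearMap.map_sub] at h
      exact h.trans_lt hT
    have hS : ‖fourierCoeff φ ρ hρ n S y - fourierCoeff φ ρ hρ n S x‖ < 2 * (ε / 5) := by
      by_cases hn : n < N
      · exact (hy n (Finset.mem_range.2 hn)).trans (by linarith)
      · have hb (z : X) : ‖fourierCoeff φ ρ hρ n S z‖ < ε / 5 :=
          (norm_apply_le _ z).trans_lt (hN n (not_lt.1 hn))
        exact (norm_sub_le _ _).trans_lt (by linarith [hb x, hb y])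
    have hx := hdiff x
    rw [norm_sub_rev] at hx
    calc ‖fourierCoeff φ ρ hρ n T y - fourierCoeff φ ρ hρ n T x‖
        = ‖(fourierCoeff φ ρ hρ n T y - fourierCoeff φ ρ hρ n S y) +
            (fourierCoeff φ ρ hρ n S y - fourierCoeff φ ρ hρ n S x) +
            (fourierCoeff φ ρ hρ n S x - fourierCoeff φ ρ hρ n T x)‖ := by congr 1; ring
      _ ≤ _ := norm_add₃_le
      _ < ε := by linarith [hdiff y]

/-- If `A` is compact, the elements `A Uˡg A` with `‖g‖ ≤ 1` lie in a compact set. -/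
theorem IsCompactElement.exists_isCompact {A : product φ ρ} (hA : IsCompactElement A) :
    ∃ K : Set (product φ ρ), IsCompact K ∧
      ∀ l g, ‖g‖ ≤ 1 → A * generator φ ρ l g * A ∈ K := by
  have h : IsCompactOperator
      (ContinuousLinearMap.mulLeftRight ℂ (product φ ρ) A A).toLinearMap := hA
  obtain ⟨K, hK, hsub⟩ := h.image_closedBall_subset_compact 1
  refine ⟨K, hK, fun l g hg => hsub ⟨generator φ ρ l g, ?_, ?_⟩⟩
  · rw [mem_closedBall_zero_iff]
    exact (norm_generator_le φ ρ l g).trans hg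
  · rfl

theorem iterate_ne_of_notMem_recurrentPoints {x : X} (hx : x ∉ recurrentPoints φ) {p : ℕ}
    (hp : 0 < p) : φ^[p] x ≠ x := by
  intro h
  refine hx ⟨fun k => p * k, fun a b hab => Nat.mul_lt_mul_of_pos_left hab hp, ?_⟩
  have (k : ℕ) : φ^[p * k] x = x := by
    rw [Function.iterate_mul]
    exact Function.iterate_fixed h k
  simpa only [this] using tendsto_const_nhds

/-- Periodic points are recurrent. Injectivity is what allows a bump at `φ^[n] x` to vanish at the
other points of an orbit segment. -/
theorem iterate_injective_of_notMem_recurrentPoints {x : X} (hx : x ∉ recurrentPoints φ) :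
    Function.Injective fun n => φ^[n] x := by
  intro i j hij
  wlog hlt : i < j generalizing i j
  · by_contra hne
    exact hne (this hij.symm (lt_of_le_of_ne (not_lt.1 hlt) (Ne.symm hne))).symm
  exfalso
  refine iterate_ne_of_notMem_recurrentPoints φ hx (Nat.sub_pos_of_lt hlt) ?_
  refine φ.injective.iterate i ?_
  rw [← Function.iterate_add_apply, Nat.add_sub_cancel' hlt.le]
  exact hij.symm

variable [LocallyCompactSpace X] [T2Space X]

/-- With `l = u k - m`, the middle term of the coefficient of index `2m + l` tends to `f_m(x)²`,
since `φ^{m+l} x = φ^{u k} x → x`. Every other term has `i < m` or `j < m` and is removed by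
induction or by the bump, while the whole coefficient tends to 0 by uniform decay. -/
theorem IsCompactElement.fourierCoeff_eq_zero {A : product φ ρ} (hA : IsCompactElement A) {x : X}
    (hx : x ∈ recurrentPoints φ) (m : ℕ) : fourierCoeff φ ρ hρ m A x = 0 := by
  obtain ⟨u, hu, hlim⟩ := hx
  obtain ⟨K, hK, hAK⟩ := hA.exists_isCompact
  induction m using Nat.strong_induction_on with
  | _ m ih =>
  set f := fun n => fourierCoeff φ ρ hρ n A with hf
  -- The point `φ^[m] x` is removed from the zero set because a recurrent orbit may be periodic and
  -- return to it at another index.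
  obtain ⟨g, hg1, hg, hg0⟩ := exists_bump (φ^[m] x)
    (s := (fun n => φ^[n] x) '' Set.Iic (2 * m) \ {φ^[m] x})
    (((Set.finite_Iic _).image _).sdiff) (by simp)
  have hzero : Tendsto (fun k => fourierCoeff φ ρ hρ (2 * m + (u k - m))
      (A * generator φ ρ (u k - m) g * A) x) atTop (𝓝 0) := by
    rw [NormedAddGroup.tendsto_nhds_zero]
    intro ε hε
    have hk : Tendsto (fun k => 2 * m + (u k - m)) atTop atTop :=
      tendsto_atTop_mono (fun k => show u k ≤ _ by omega) hu.tendsto_atTop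
    filter_upwards [hk.eventually (eventually_norm_fourierCoeff_lt φ ρ hρ hK hε)] with k h
    exact (norm_apply_le _ x).trans_lt (h _ (hAK _ g hg1))
  have hmul : Tendsto (fun k => fourierCoeff φ ρ hρ (2 * m + (u k - m))
      (A * generator φ ρ (u k - m) g * A) x) atTop (𝓝 (f m x * f m x)) := by
    simp only [fourierCoeff_mul_generator_mul]
    have hterm : ∀ p ∈ Finset.HasAntidiagonal.antidiagonal (2 * m),
        Tendsto (fun k => f p.1 (φ^[p.2 + (u k - m)] x) * g (φ^[p.2] x) * f p.2 x) atTop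
          (𝓝 (if p = (m, m) then f m x * f m x else 0)) := by
      rintro ⟨i, j⟩ hij
      rw [Finset.HasAntidiagonal.mem_antidiagonal] at hij
      simp only at hij ⊢
      rcases lt_trichotomy j m with hj | rfl | hj
      · rw [if_neg (by simp; omega)]
        simp [hf, ih j hj]
      · obtain rfl : i = j := by omega
        rw [if_pos rfl]
        have h1 : Tendsto (fun k => f i (φ^[u k] x)) atTop (𝓝 (f i x)) :=
          ((f i).continuous.tendsto x).comp hlim
        refine (h1.mul_const (f i x)).congr' ?_
        filter_upwards [hu.tendsto_atTop.eventually_ge_atTop i] with k hk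
        rw [hg.self_of_nhds, mul_one, Nat.add_sub_cancel' hk]
      · rw [if_neg (by simp; omega)]
        -- If the bump does not kill this term, `x` has period `j - m`, so the first factor tends to
        -- `f i x`, which is 0 by induction as `i < m`.
        by_cases hjm : φ^[j] x = φ^[m] x
        · have hper : φ^[j - m] x = x := by
            have : φ^[m] (φ^[j - m] x) = φ^[m] x := by
              rw [← Function.iterate_add_apply, Nat.add_sub_cancel' hj.le, hjm]
            exact φ.injective.iterate m this
          have h1 : Tendsto (fun k => f i (φ^[j - m] (φ^[u k] x))) atTop (𝓝 0) := by
            have h2 : Continuous fun y => f i (φ^[j - m] y) :=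
              (f i).continuous.comp (φ.continuous.iterate _)
            have h3 := (h2.tendsto x).comp hlim
            rw [hper] at h3
            simpa [hf, ih i (by omega), Function.comp_def] using h3
          have h4 := (h1.mul_const (g (φ^[j] x))).mul_const (f j x)
          rw [zero_mul, zero_mul] at h4
          refine h4.congr' ?_
          filter_upwards [hu.tendsto_atTop.eventually_ge_atTop m] with k hk
          rw [← Function.iterate_add_apply, show j - m + u k = j + (u k - m) by omega]
        · have h0 := (hg0 (φ^[j] x) ⟨⟨j, by simp; omega, rfl⟩, hjm⟩).self_of_nhds
          simp [h0]
    have := tendsto_finsetSum _ hterm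
    rwa [Finset.sum_ite_eq', if_pos (by simp [two_mul])] at this
  simpa [hf] using tendsto_nhds_unique hmul hzero

/-- At points where only the `n`-th term survives, the coefficient is a single product. -/
theorem fourierCoeff_mul_generator_mul_eq (A : product φ ρ) {m n : ℕ} (l : ℕ) {g : C₀(X, ℂ)} {x : X}
    (h1 : g (φ^[n] x) = 1) (h0 : ∀ j ≤ m + n, j ≠ n → g (φ^[j] x) = 0) :
    fourierCoeff φ ρ hρ (m + n + l) (A * generator φ ρ l g * A) x =
      fourierCoeff φ ρ hρ m A (φ^[n + l] x) * fourierCoeff φ ρ hρ n A x := by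
  rw [fourierCoeff_mul_generator_mul, Finset.sum_eq_single (m, n)]
  · simp [h1]
  · rintro ⟨i, j⟩ hij hne
    rw [Finset.HasAntidiagonal.mem_antidiagonal] at hij
    simp only at hij ⊢
    rw [h0 j (by omega) (by rintro rfl; exact hne (by simp; omega))]
    simp
  · simp

/-- For nonrecurrent `x`, pick `y ≠ x` nearby and a bump that isolates the product at `x` but
vanishes on the orbit segment of `y`. The coefficient is the product at `x` and 0 at `y`;
equicontinuity with `ε` equal to the norm of the product is then absurd. -/
theorem IsCompactElement.mul_eq_zero {A : product φ ρ} (hA : IsCompactElement A) {x : X}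
    (hx : x ∈ accumulationPoints X) (m n l : ℕ) :
    fourierCoeff φ ρ hρ m A (φ^[n + l] x) * fourierCoeff φ ρ hρ n A x = 0 := by
  by_cases hr : x ∈ recurrentPoints φ
  · rw [hA.fourierCoeff_eq_zero φ ρ hρ hr n, mul_zero]
  have hinj := iterate_injective_of_notMem_recurrentPoints φ hr
  obtain ⟨K, hK, hAK⟩ := hA.exists_isCompact
  by_contra hc
  have hev := eventually_dist_fourierCoeff_lt φ ρ hρ hK x (norm_pos_iff.2 hc)
  have hne : ∀ᶠ y in 𝓝[≠] x, ∀ j ∈ Finset.range (m + n + 1), φ^[j] y ≠ φ^[n] x := by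
    rw [Filter.eventually_all_finset]
    intro j _
    by_cases hj : j = n
    · subst hj
      filter_upwards [self_mem_nhdsWithin] with y hy h
      exact hy (φ.injective.iterate j h)
    · exact ((φ.continuous.iterate j).continuousAt.eventually_ne
        (fun h => hj (hinj h))).filter_mono nhdsWithin_le_nhds
  have hx' : (𝓝[≠] x).NeBot := by
    have := hx
    rwa [accumulationPoints, mem_derivedSet, AccPt, principal_univ, inf_top_eq] at this
  obtain ⟨y, hy, hyne⟩ := ((hev.filter_mono nhdsWithin_le_nhds).and hne).exists
  obtain ⟨g, hg1, hg, hg0⟩ := exists_bump (φ^[n] x)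
    (s := (fun j => φ^[j] x) '' (Set.Iic (m + n) \ {n}) ∪ (fun j => φ^[j] y) '' Set.Iic (m + n))
    ((((Set.finite_Iic _).sdiff).image _).union ((Set.finite_Iic _).image _)) (by
      rintro (⟨j, hj, h⟩ | ⟨j, hj, h⟩)
      · exact hj.2 (hinj h)
      · exact hyne j (by simp at hj ⊢; omega) h)
  have h := hy _ (hAK l g hg1) (m + n + l)
  rw [fourierCoeff_mul_generator_mul_eq φ ρ hρ A l hg.self_of_nhds (fun j hj hjn =>
    (hg0 _ (Or.inl ⟨j, ⟨hj, hjn⟩, rfl⟩)).self_of_nhds), fourierCoeff_mul_generator_mul,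
    Finset.sum_eq_zero, zero_sub, norm_neg] at h
  · exact lt_irrefl _ h
  · rintro ⟨i, j⟩ hij
    rw [Finset.HasAntidiagonal.mem_antidiagonal] at hij
    simp only at hij ⊢
    rw [(hg0 _ (Or.inr ⟨j, by simp; omega, rfl⟩)).self_of_nhds]
    simp

/-- At a recurrent point `f_n` vanishes and `‖f_m‖ |f_n(y)|` bounds all the products at once.
Elsewhere one bump, locally constant near the orbit segment, isolates the product at every `y` near
`x`, so equicontinuity passes from the compact set. -/
theorem IsCompactElement.equicontinuous {A : product φ ρ} (hA : IsCompactElement A) (m n : ℕ) :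
    Equicontinuous fun (l : ℕ) (x : X) =>
      fourierCoeff φ ρ hρ m A (φ^[n + l] x) * fourierCoeff φ ρ hρ n A x := by
  intro x
  rw [Metric.equicontinuousAt_iff_right]
  intro ε hε
  by_cases hr : x ∈ recurrentPoints φ
  · have h0 := hA.fourierCoeff_eq_zero φ ρ hρ hr n
    have hlim : Tendsto (fun y => ‖fourierCoeff φ ρ hρ m A‖ * ‖fourierCoeff φ ρ hρ n A y‖) (𝓝 x)
        (𝓝 0) := by
      have := ((fourierCoeff φ ρ hρ n A).continuous.norm.tendsto x).const_mul
        ‖fourierCoeff φ ρ hρ m A‖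
      simpa [h0] using this
    filter_upwards [hlim.eventually_lt_const hε] with y hy l
    rw [h0, mul_zero, dist_zero_left, norm_mul]
    exact (mul_le_mul_of_nonneg_right (norm_apply_le _ _) (norm_nonneg _)).trans_lt hy
  · have hinj := iterate_injective_of_notMem_recurrentPoints φ hr
    obtain ⟨K, hK, hAK⟩ := hA.exists_isCompact
    obtain ⟨g, hg1, hg, hg0⟩ := exists_bump (φ^[n] x)
      (s := (fun j => φ^[j] x) '' (Set.Iic (m + n) \ {n}))
      (((Set.finite_Iic _).sdiff).image _) (by
        rintro ⟨j, hj, h⟩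
        exact hj.2 (hinj h))
    have h1 : ∀ᶠ y in 𝓝 x, g (φ^[n] y) = 1 := (φ.continuous.iterate n).tendsto x hg
    have h0 : ∀ᶠ y in 𝓝 x, ∀ j ∈ Finset.range (m + n + 1), j ≠ n → g (φ^[j] y) = 0 := by
      rw [Filter.eventually_all_finset]
      intro j hj
      by_cases hjn : j = n
      · simp [hjn]
      · filter_upwards [(φ.continuous.iterate j).tendsto x
          (hg0 _ ⟨j, ⟨by simp at hj ⊢; omega, hjn⟩, rfl⟩)] with y hy _ using hy
    have key {y : X} (hy1 : g (φ^[n] y) = 1)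
        (hy0 : ∀ j ∈ Finset.range (m + n + 1), j ≠ n → g (φ^[j] y) = 0) (l : ℕ) :=
      fourierCoeff_mul_generator_mul_eq φ ρ hρ A l hy1
        (fun j hj hjn => hy0 j (by simp; omega) hjn)
    filter_upwards [h1, h0, eventually_dist_fourierCoeff_lt φ ρ hρ hK x hε] with y hy1 hy0 hy l
    have := hy _ (hAK l g hg1) (m + n + l)
    rwa [key hy1 hy0, key h1.self_of_nhds h0.self_of_nhds, ← dist_eq_norm, dist_comm] at this

end Necessity

/-! ### Fejér's theorem via the gauge action -/

section Fejer

/-- The `n`-th Fourier coefficient of the Fejér kernel, computed by discrete sampling. -/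
theorem sum_fejer_mul_pow {Q : ℕ} {ω : ℂ} (hω : IsPrimitiveRoot ω Q) {n N : ℕ} (hQ : n + N ≤ Q) :
    ∑ j ∈ Finset.range Q, ((‖∑ a ∈ Finset.range N, (ω ^ j) ^ a‖ ^ 2 : ℝ) : ℂ) * (ω ^ j) ^ n =
      Q * (N - n : ℕ) := by
  rcases Nat.eq_zero_or_pos Q with rfl | hQ0
  · simp
  have hω1 : ‖ω‖ = 1 := hω.norm'_eq_one hQ0.ne'
  have hω0 : ω ≠ 0 := by rintro rfl; simp at hω1
  have hinner (a b : ℕ) (ha : a < N) (hb : b < N) :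
      ∑ j ∈ Finset.range Q, (ω ^ ((a + n : ℤ) - b)) ^ j = if a + n = b then (Q : ℂ) else 0 := by
    split_ifs with h
    · simp [show (a + n : ℤ) - b = 0 by omega]
    · have h1 : ω ^ ((a + n : ℤ) - b) ≠ 1 := by
        rw [Ne, hω.zpow_eq_one_iff_dvd]
        intro hd
        -- The exponent `a + n - b` lies strictly between `-Q` and `Q`; this is where `n + N ≤ Q`
        -- enters.
        have := Int.eq_zero_of_abs_lt_dvd hd (by rw [abs_lt]; constructor <;> omega)
        omega
      have h2 : (ω ^ ((a + n : ℤ) - b)) ^ Q = 1 := by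
        rw [← zpow_natCast, zpow_comm, zpow_natCast, hω.pow_eq_one, one_zpow]
      rw [geom_sum_eq h1, h2]
      simp
  have hterm (j : ℕ) : ((‖∑ a ∈ Finset.range N, (ω ^ j) ^ a‖ ^ 2 : ℝ) : ℂ) * (ω ^ j) ^ n =
      ∑ a ∈ Finset.range N, ∑ b ∈ Finset.range N, (ω ^ ((a + n : ℤ) - b)) ^ j := by
    rw [Complex.ofReal_pow, ← Complex.mul_conj', map_sum, Finset.sum_mul_sum, Finset.sum_mul]
    refine Finset.sum_congr rfl fun a _ => ?_
    rw [Finset.sum_mul]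
    refine Finset.sum_congr rfl fun b _ => ?_
    have hconj : (starRingEnd ℂ) ω = ω⁻¹ := (Complex.inv_eq_conj hω1).symm
    rw [zpow_sub₀ hω0, map_pow, map_pow, hconj, div_pow, ← Nat.cast_add, zpow_natCast,
      zpow_natCast, inv_pow, inv_pow, div_eq_mul_inv, pow_right_comm ω b j, pow_add, mul_pow,
      pow_right_comm ω a j, pow_right_comm ω n j]
    ring
  simp only [hterm]
  rw [Finset.sum_comm]
  have hcount : ∀ a ∈ Finset.range N, ∑ j ∈ Finset.range Q, ∑ b ∈ Finset.range N,
      (ω ^ ((a + n : ℤ) - b)) ^ j = if a ∈ Finset.range (N - n) then (Q : ℂ) else 0 := by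
    intro a ha
    rw [Finset.sum_comm, Finset.sum_congr rfl fun b hb =>
      hinner a b (Finset.mem_range.1 ha) (Finset.mem_range.1 hb), Finset.sum_ite_eq]
    congr 1
    simp only [Finset.mem_range, eq_iff_iff]
    omega
  rw [Finset.sum_congr rfl hcount, Finset.sum_ite_mem, Finset.inter_eq_right.2
    (Finset.range_subset_range.2 (Nat.sub_le N n))]
  simp [mul_comm]

variable {H₀ : Type*} [NormedAddCommGroup H₀] [InnerProductSpace ℂ H₀]

/-- The diagonal unitary `ξ ⊗ e_k ↦ zᵏ ξ ⊗ e_k`, as a bounded operator. -/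
def rotation (z : Circle) : TensorL2 H₀ →L[ℂ] TensorL2 H₀ :=
  have hn (ξ : TensorL2 H₀) (k : ℕ) : ‖(z : ℂ) ^ k • ξ k‖ = ‖ξ k‖ := by
    rw [norm_smul, norm_pow, Circle.norm_coe, one_pow, one_mul]
  have hm (ξ : TensorL2 H₀) : Memℓp (fun k => (z : ℂ) ^ k • ξ k) 2 := by
    refine memℓp_gen ?_
    simp only [hn]
    exact (lp.memℓp ξ).summable (by simp)
  LinearMap.mkContinuous
    { toFun ξ := ⟨fun k => (z : ℂ) ^ k • ξ k, hm ξ⟩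
      map_add' ξ η := by ext k; exact smul_add _ _ _
      map_smul' c ξ := by ext k; exact smul_comm _ _ _ }
    1 fun ξ => by
      refine lp.norm_le_of_tsum_le (by simp) (by positivity) ?_
      rw [one_mul, lp.norm_rpow_eq_tsum (by simp)]
      exact (tsum_congr fun k => by congr 1; exact hn ξ k).le

theorem rotation_apply (z : Circle) (ξ : TensorL2 H₀) (k : ℕ) :
    rotation z ξ k = (z : ℂ) ^ k • ξ k := rfl

theorem norm_rotation_le (z : Circle) : ‖(rotation z : TensorL2 H₀ →L[ℂ] TensorL2 H₀)‖ ≤ 1 := by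
  unfold rotation
  exact LinearMap.mkContinuous_norm_le _ zero_le_one _

variable {X : Type*} [TopologicalSpace X] (φ : X ≃ₜ X) [CompleteSpace H₀]
  (ρ : C₀(X, ℂ) →⋆ₙₐ[ℂ] (H₀ →L[ℂ] H₀)) (hρ : Function.Injective ρ)

theorem rotation_mul_monomial_mul_rotation (z : Circle) (n : ℕ) (f : C₀(X, ℂ)) :
    rotation z * monomial φ ρ n f * rotation z⁻¹ = (z : ℂ) ^ n • monomial φ ρ n f := by
  ext ξ k
  simp only [mul_apply_eq_comp, rotation_apply, monomial_apply, smul_apply, lp.coeFn_smul,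
    Pi.smul_apply]
  split_ifs with h
  · rw [map_smul, smul_smul, Circle.coe_inv, inv_pow]
    congr 1
    have hz : (z : ℂ) ≠ 0 := z.coe_ne_zero
    rw [← Nat.add_sub_cancel' h, pow_add, Nat.add_sub_cancel_left, mul_assoc,
      mul_inv_cancel₀ (pow_ne_zero _ hz), mul_one]
  · simp

/-- The Cesàro mean `∑_{n < N} (1 - n / N) Uⁿ Eₙ(T)` of the Fourier series of `T`. -/
def cesaroMean (N : ℕ) (T : product φ ρ) : product φ ρ :=
  ∑ n ∈ Finset.range N, (((N - n : ℕ) : ℂ) / N) • generator φ ρ n (fourierCoeff φ ρ hρ n T)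

theorem cesaroMean_sub (N : ℕ) (S T : product φ ρ) :
    cesaroMean φ ρ hρ N (S - T) = cesaroMean φ ρ hρ N S - cesaroMean φ ρ hρ N T := by
  simp only [cesaroMean, ContinuousLinearMap.map_sub, LinearMap.map_sub, smul_sub,
    Finset.sum_sub_distrib]

theorem continuous_cesaroMean (N : ℕ) : Continuous (cesaroMean φ ρ hρ N) :=
  continuous_finsetSum _ fun n _ =>
    continuous_const_smul _ |>.comp
      ((continuous_generator φ ρ n).comp (fourierCoeff φ ρ hρ n).continuous)

theorem fourierCoeff_sum_generator (M n : ℕ) (F : ℕ → C₀(X, ℂ)) :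
    fourierCoeff φ ρ hρ n (∑ m ∈ Finset.range M, generator φ ρ m (F m)) =
      if n < M then F n else 0 := by
  rw [map_sum]
  simp only [fourierCoeff_generator]
  simp

theorem cesaroMean_sum_generator (N M : ℕ) (F : ℕ → C₀(X, ℂ)) :
    cesaroMean φ ρ hρ N (∑ m ∈ Finset.range M, generator φ ρ m (F m)) =
      ∑ n ∈ Finset.range M, (((N - n : ℕ) : ℂ) / N) • generator φ ρ n (F n) := by
  have h1 : cesaroMean φ ρ hρ N (∑ m ∈ Finset.range M, generator φ ρ m (F m)) =
      ∑ n ∈ Finset.range N, if n ∈ Finset.range M then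
        (((N - n : ℕ) : ℂ) / N) • generator φ ρ n (F n) else 0 := by
    refine Finset.sum_congr rfl fun n _ => ?_
    rw [fourierCoeff_sum_generator]
    simp only [Finset.mem_range]
    split_ifs
    · rfl
    · rw [LinearMap.map_zero]
      exact smul_zero (A := product φ ρ) _
  rw [h1, Finset.sum_ite_mem]
  refine Finset.sum_subset Finset.inter_subset_right fun n hn hn' => ?_
  have : N - n = 0 := by simp at hn hn'; omega
  simp [this]

/-- The left-hand sum is an average of conjugates of the right-hand one by diagonal unitaries. The
weights are samples of the Fejér kernel at roots of unity: nonnegative, with total mass 1 after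
division by `Q * N`. -/
theorem norm_sum_cesaro_le (N M : ℕ) (F : ℕ → C₀(X, ℂ)) :
    ‖∑ n ∈ Finset.range M, (((N - n : ℕ) : ℂ) / N) • monomial φ ρ n (F n)‖ ≤
      ‖∑ n ∈ Finset.range M, monomial φ ρ n (F n)‖ := by
  rcases Nat.eq_zero_or_pos N with rfl | hN
  · simp
  set T := ∑ n ∈ Finset.range M, monomial φ ρ n (F n) with hT
  -- This many sample points make the discrete Fejér sums exact for every `n < M`.
  set Q := M + N with hQ
  have hQ0 : Q ≠ 0 := by omega
  have hω := Complex.isPrimitiveRoot_exp Q hQ0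
  set ω := Complex.exp (2 * Real.pi * Complex.I / Q)
  have hω1 : ‖ω‖ = 1 := hω.norm'_eq_one hQ0
  set z : Circle := ⟨ω, by simp [Submonoid.unitSphere, hω1]⟩ with hz
  set w : ℕ → ℝ := fun j => ‖∑ a ∈ Finset.range N, (ω ^ j) ^ a‖ ^ 2 with hw
  have hsum : ∑ j ∈ Finset.range Q, w j = Q * N := by
    have h := sum_fejer_mul_pow hω (n := 0) (N := N) (by omega)
    simp only [pow_zero, mul_one, Nat.sub_zero] at h
    exact_mod_cast h
  have hrep : ∑ n ∈ Finset.range M, (((N - n : ℕ) : ℂ) / N) • monomial φ ρ n (F n) =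
      ((Q * N : ℝ) : ℂ)⁻¹ • ∑ j ∈ Finset.range Q,
        (w j : ℂ) • (rotation (z ^ j) * T * rotation (z ^ j)⁻¹) := by
    have hterm (j : ℕ) : (w j : ℂ) • (rotation (z ^ j) * T * rotation (z ^ j)⁻¹) =
        ∑ n ∈ Finset.range M, ((w j : ℂ) * (ω ^ j) ^ n) • monomial φ ρ n (F n) := by
      rw [hT, Finset.mul_sum, Finset.sum_mul, Finset.smul_sum]
      refine Finset.sum_congr rfl fun n _ => ?_
      rw [rotation_mul_monomial_mul_rotation, smul_smul, Circle.coe_pow]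
    simp only [hterm]
    rw [Finset.sum_comm, Finset.smul_sum]
    refine Finset.sum_congr rfl fun n hn => ?_
    rw [← Finset.sum_smul, sum_fejer_mul_pow hω (by simp at hn; omega), smul_smul]
    congr 1
    push_cast
    have : (N : ℂ) ≠ 0 := by exact_mod_cast hN.ne'
    have : (Q : ℂ) ≠ 0 := by exact_mod_cast hQ0
    field_simp
  have hconj (j : ℕ) : ‖rotation (z ^ j) * T * rotation (z ^ j)⁻¹‖ ≤ ‖T‖ := by
    calc ‖rotation (z ^ j) * T * rotation (z ^ j)⁻¹‖
        ≤ ‖(rotation (z ^ j) : TensorL2 H₀ →L[ℂ] TensorL2 H₀)‖ * ‖T‖ *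
          ‖(rotation (z ^ j)⁻¹ : TensorL2 H₀ →L[ℂ] TensorL2 H₀)‖ := norm_mul₃_le
      _ ≤ 1 * ‖T‖ * 1 := by
        gcongr
        · exact norm_rotation_le _
        · exact norm_rotation_le _
      _ = ‖T‖ := by ring
  have hQN : (0 : ℝ) < Q * N := by positivity
  rw [hrep, norm_smul, norm_inv, Complex.norm_real, Real.norm_of_nonneg hQN.le,
    inv_mul_le_iff₀ hQN, ← hsum, Finset.sum_mul]
  refine norm_sum_le_of_le _ fun j _ => ?_
  rw [norm_smul, Complex.norm_real, Real.norm_of_nonneg (by positivity)]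
  exact mul_le_mul_of_nonneg_left (hconj j) (by positivity)

theorem coe_sum_smul_generator (M : ℕ) (c : ℕ → ℂ) (F : ℕ → C₀(X, ℂ)) :
    ((∑ n ∈ Finset.range M, c n • generator φ ρ n (F n) : product φ ρ) :
      TensorL2 H₀ →L[ℂ] TensorL2 H₀) = ∑ n ∈ Finset.range M, c n • monomial φ ρ n (F n) := by
  induction M with
  | zero => rfl
  | succ M ih => rw [Finset.sum_range_succ, Finset.sum_range_succ, ← ih]; rfl

theorem coe_sum_generator (M : ℕ) (F : ℕ → C₀(X, ℂ)) :
    ((∑ n ∈ Finset.range M, generator φ ρ n (F n) : product φ ρ) :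
      TensorL2 H₀ →L[ℂ] TensorL2 H₀) = ∑ n ∈ Finset.range M, monomial φ ρ n (F n) := by
  induction M with
  | zero => rfl
  | succ M ih => rw [Finset.sum_range_succ, Finset.sum_range_succ, ← ih]; rfl

theorem norm_cesaroMean_le (N : ℕ) (T : product φ ρ) : ‖cesaroMean φ ρ hρ N T‖ ≤ ‖T‖ := by
  revert T
  refine product_induction_sum φ ρ
    (isClosed_le (continuous_cesaroMean φ ρ hρ N).norm continuous_norm) fun M F => ?_
  rw [cesaroMean_sum_generator]
  have h := norm_sum_cesaro_le φ ρ N M F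
  rw [← coe_sum_smul_generator, ← coe_sum_generator] at h
  exact h

/-- Fejér's theorem in the semicrossed product. -/
theorem tendsto_cesaroMean (T : product φ ρ) :
    Tendsto (fun N => cesaroMean φ ρ hρ N T) atTop (𝓝 T) := by
  revert T
  refine product_induction_sum φ ρ ?_ ?_
  · rw [← closure_subset_iff_isClosed]
    intro T hT
    rw [Set.mem_ofPred_eq, Metric.tendsto_nhds]
    intro ε hε
    obtain ⟨S, hS, hST⟩ := Metric.mem_closure_iff.1 hT (ε / 3) (by positivity)
    filter_upwards [Metric.tendsto_nhds.1 hS (ε / 3) (by positivity)] with N hN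
    have h1 : dist (cesaroMean φ ρ hρ N T) (cesaroMean φ ρ hρ N S) ≤ dist T S := by
      rw [dist_eq_norm, dist_eq_norm, ← cesaroMean_sub]
      exact norm_cesaroMean_le φ ρ hρ N _
    have h2 := dist_triangle4 (cesaroMean φ ρ hρ N T) (cesaroMean φ ρ hρ N S) S T
    rw [dist_comm S T] at h2
    linarith
  · intro M F
    simp only [cesaroMean_sum_generator]
    refine tendsto_finsetSum _ fun n _ => ?_
    have h : Tendsto (fun N : ℕ => ((N - n : ℕ) : ℂ) / N) atTop (𝓝 1) := by
      have h1 : Tendsto (fun N : ℕ => 1 - (n : ℂ) / N) atTop (𝓝 1) := by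
        simpa using (tendsto_const_div_atTop_nhds_zero_nat (n : ℂ)).const_sub 1
      refine h1.congr' ?_
      filter_upwards [eventually_ge_atTop n, eventually_gt_atTop 0] with N hN hN0
      have : (N : ℂ) ≠ 0 := by exact_mod_cast hN0.ne'
      rw [Nat.cast_sub hN, sub_div, div_self this]
    simpa using h.smul_const (generator φ ρ n (F n))

end Fejer

/-! ### Compactness of two-sided multiplications -/

section CompactMultiplication

variable {B : Type*} [NonUnitalNormedRing B] [NormedSpace ℂ B] [IsScalarTower ℂ B B]
  [SMulCommClass ℂ B B]

theorem isCompactOperator_mul_mul_of_forall_mem (a b : B) (W : Submodule ℂ B)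
    [FiniteDimensional ℂ W] (h : ∀ x, a * x * b ∈ W) :
    IsCompactOperator fun x : B => a * x * b := by
  have : ProperSpace W := FiniteDimensional.proper ℂ W
  exact (isCompactOperator_of_locallyCompactSpace_dom
    ((ContinuousLinearMap.mulLeftRight ℂ B a b).codRestrict W h)).clm_comp W.subtypeL

theorem isCompactOperator_mul_mul_of_tendsto [CompleteSpace B] {u v : ℕ → B} {a b : B}
    (hu : Tendsto u atTop (𝓝 a)) (hv : Tendsto v atTop (𝓝 b))
    (h : ∀ k, IsCompactOperator fun x : B => u k * x * v k) :
    IsCompactOperator fun x : B => a * x * b := by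
  have hcont : Continuous fun p : B × B => ContinuousLinearMap.mulLeftRight ℂ B p.1 p.2 :=
    (ContinuousLinearMap.mulLeftRight ℂ B).continuous₂
  exact isCompactOperator_of_tendsto ((hcont.tendsto _).comp (hu.prodMk_nhds hv))
    (Eventually.of_forall h)

theorem isCompactElement_sum_smul {ι : Type*} (s : Finset ι) (c : ι → ℂ) (a : ι → B)
    (h : ∀ i j, IsCompactOperator fun x : B => a i * x * a j) :
    IsCompactElement (∑ i ∈ s, c i • a i) := by
  have key : ContinuousLinearMap.mulLeftRight ℂ B (∑ i ∈ s, c i • a i) (∑ i ∈ s, c i • a i) ∈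
      compactOperator (RingHom.id ℂ) B B := by
    have : ContinuousLinearMap.mulLeftRight ℂ B (∑ i ∈ s, c i • a i) (∑ i ∈ s, c i • a i) =
        ∑ i ∈ s, ∑ j ∈ s, (c j * c i) • ContinuousLinearMap.mulLeftRight ℂ B (a j) (a i) := by
      ext x
      simp [Finset.smul_sum, smul_smul, mul_comm]
    rw [this]
    exact Submodule.sum_mem _ fun i _ => Submodule.sum_mem _ fun j _ =>
      Submodule.smul_mem _ _ (h j i)
  exact key

end CompactMultiplication

/-! ### The three conditions imply compactness -/

section Sufficiency

variable {X : Type*} [TopologicalSpace X]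

/-- Soft thresholding of a function vanishing at infinity. -/
theorem exists_norm_sub_le_support (f : C₀(X, ℂ)) {ε : ℝ} (hε : 0 < ε) :
    ∃ r : C₀(X, ℂ), ‖f - r‖ ≤ ε ∧ ∀ x, r x ≠ 0 → ε < ‖f x‖ := by
  have hmax (z : ℂ) : 0 < max ε ‖z‖ := lt_max_of_lt_left hε
  -- `ψ` is 0 on the disc of radius `ε` and moves any other point radially inward by `ε`; the `max`
  -- keeps the denominator away from 0.
  set ψ : ℂ → ℂ := fun z => z - ε / (max ε ‖z‖ : ℝ) * z with hψ
  have hcont : Continuous ψ := by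
    refine continuous_id.sub ((continuous_const.div (by fun_prop) fun z => ?_).mul continuous_id)
    exact_mod_cast (hmax z).ne'
  refine ⟨⟨⟨fun x => ψ (f x), hcont.comp f.continuous⟩, ?_⟩, ?_, ?_⟩
  · have := (hcont.tendsto 0).comp (zero_at_infty f)
    have h0 : ψ 0 = 0 := by simp [hψ]
    rwa [h0] at this
  · refine norm_le_of_forall_apply_le hε.le fun x => ?_
    change ‖f x - (f x - ε / (max ε ‖f x‖ : ℝ) * f x)‖ ≤ ε
    rw [sub_sub_cancel, norm_mul, norm_div, Complex.norm_real, Complex.norm_real,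
      Real.norm_of_nonneg hε.le, Real.norm_of_nonneg (hmax _).le, div_mul_eq_mul_div,
      div_le_iff₀ (hmax _)]
    exact mul_le_mul_of_nonneg_left (le_max_right _ _) hε.le
  · intro x hx
    by_contra hle
    refine hx ?_
    change f x - ε / (max ε ‖f x‖ : ℝ) * f x = 0
    rw [max_eq_left (not_lt.1 hle), div_self (by exact_mod_cast hε.ne'), one_mul, sub_self]

/-- The functions in `C₀(X)` supported in a given set. -/
def supportedIn (s : Set X) : Submodule ℂ C₀(X, ℂ) where
  carrier := {f | ∀ x ∉ s, f x = 0}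
  add_mem' {f g} hf hg x hx := by simp [hf x hx, hg x hx]
  zero_mem' x _ := rfl
  smul_mem' c f hf x hx := by simp [hf x hx]

theorem finiteDimensional_supportedIn {s : Set X} (hs : s.Finite) :
    FiniteDimensional ℂ (supportedIn s) := by
  have := hs.to_subtype
  refine FiniteDimensional.of_injective
    (V₂ := s → ℂ)
    { toFun f x := (f : C₀(X, ℂ)) x
      map_add' _ _ := rfl
      map_smul' _ _ := rfl } fun f g hfg => ?_
  ext x
  by_cases hx : x ∈ s
  · exact congrFun hfg ⟨x, hx⟩
  · rw [f.2 x hx, g.2 x hx]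

variable (φ : X ≃ₜ X)
  {H₀ : Type*} [NormedAddCommGroup H₀] [InnerProductSpace ℂ H₀] [CompleteSpace H₀]
  (ρ : C₀(X, ℂ) →⋆ₙₐ[ℂ] (H₀ →L[ℂ] H₀)) (hρ : Function.Injective ρ)

/-- Two-sided multiplication by generators has finite rank when only finitely many matrix
coefficients survive. -/
theorem isCompactOperator_generator_of_finite {m n : ℕ} {r s : C₀(X, ℂ)} {F : Set X}
    (hF : F.Finite) {L : ℕ} (h : ∀ l x, r (φ^[n + l] x) * s x ≠ 0 → x ∈ F ∧ l < L) :
    IsCompactOperator fun T => generator φ ρ m r * T * generator φ ρ n s := by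
  have := finiteDimensional_supportedIn hF
  -- The image of `Uˡg` is `U^{m+l+n}` times a function supported in `F`, and is zero for `l ≥ L`.
  -- As `W` is finite-dimensional it is closed, so generators suffice.
  set W : Submodule ℂ (product φ ρ) := (Finset.range L).sup fun l =>
    (supportedIn F).map (generator φ ρ (m + l + n)) with hW
  refine isCompactOperator_mul_mul_of_forall_mem _ _ W fun T => ?_
  refine product_induction φ ρ (p := fun T => generator φ ρ m r * T * generator φ ρ n s ∈ W)
    ?_ ?_ ?_ T
  · exact (Submodule.closed_of_finiteDimensional W).preimage
      ((continuous_const.mul continuous_id).mul continuous_const)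
  · intro l g
    rw [generator_mul_generator, generator_mul_generator]
    have hval (x : X) : (α φ n (α φ l r * g) * s) x = r (φ^[n + l] x) * s x * g (φ^[n] x) := by
      simp only [ZeroAtInftyContinuousMap.coe_mul, Pi.mul_apply, α_apply]
      rw [← Function.iterate_add_apply, Nat.add_comm l n]
      ring
    by_cases hl : l < L
    · refine (Finset.le_sup (f := fun l => (supportedIn F).map (generator φ ρ (m + l + n)))
        (Finset.mem_range.2 hl)) (Submodule.mem_map_of_mem fun x hx => ?_)
      rw [hval]
      by_contra hne
      exact hx (h l x (left_ne_zero_of_mul hne)).1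
    · have h0 : α φ n (α φ l r * g) * s = 0 := by
        ext x
        rw [hval]
        by_contra hne
        exact hl (h l x (left_ne_zero_of_mul hne)).2
      rw [h0, LinearMap.map_zero]
      exact W.zero_mem
  · intro S T hS hT
    rw [mul_add, add_mul]
    exact W.add_mem hS hT

/-- Soft thresholding of `f` and `g` at level `1 / (k + 1)` gives finite-rank maps, and these
converge in norm as `k → ∞`. -/
theorem isCompactOperator_generator {m n : ℕ} {f g : C₀(X, ℂ)}
    (h : ∀ ε > 0, ∃ F : Set X, F.Finite ∧ ∃ L : ℕ, ∀ l x, ε < ‖f (φ^[n + l] x)‖ → ε < ‖g x‖ →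
      x ∈ F ∧ l < L) :
    IsCompactOperator fun T => generator φ ρ m f * T * generator φ ρ n g := by
  have happrox (f : C₀(X, ℂ)) : ∃ r : ℕ → C₀(X, ℂ), Tendsto r atTop (𝓝 f) ∧
      ∀ k x, r k x ≠ 0 → 1 / ((k : ℝ) + 1) < ‖f x‖ := by
    choose r hr hr' using fun k : ℕ =>
      exists_norm_sub_le_support f (ε := 1 / ((k : ℝ) + 1)) Nat.one_div_pos_of_nat
    refine ⟨r, ?_, hr'⟩
    rw [tendsto_iff_norm_sub_tendsto_zero]
    refine squeeze_zero (fun _ => norm_nonneg _) (fun k => ?_)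
      tendsto_one_div_add_atTop_nhds_zero_nat
    rw [norm_sub_rev]
    exact hr k
  obtain ⟨r, hr, hr0⟩ := happrox f
  obtain ⟨s, hs, hs0⟩ := happrox g
  refine isCompactOperator_mul_mul_of_tendsto (((continuous_generator φ ρ m).tendsto f).comp hr)
    (((continuous_generator φ ρ n).tendsto g).comp hs) fun k => ?_
  obtain ⟨F, hF, L, hL⟩ := h (1 / ((k : ℝ) + 1)) Nat.one_div_pos_of_nat
  exact isCompactOperator_generator_of_finite φ ρ hF fun l x hx =>
    hL l x (hr0 k _ (left_ne_zero_of_mul hx)) (hs0 k _ (right_ne_zero_of_mul hx))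

theorem isCompact_setOf_le_norm (f : C₀(X, ℂ)) {ε : ℝ} (hε : 0 < ε) :
    IsCompact {x | ε ≤ ‖f x‖} := by
  have h := (zero_at_infty f).norm.eventually_lt_const (by simpa using hε)
  obtain ⟨K, hK, hsub⟩ := mem_cocompact.1 h
  refine hK.of_isClosed_subset (isClosed_le continuous_const f.continuous.norm) fun x hx => ?_
  by_contra hxK
  exact not_lt_of_ge (show ε ≤ ‖f x‖ from hx) (show ‖f x‖ < ε from hsub hxK)

/-- An infinite set of this kind would accumulate in the compact set `{ε ≤ ‖g‖}`. At the
accumulation point all products vanish, so nearby they are below `ε²` for every `l`, contrary to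
membership. -/
theorem finite_setOf_lt_norm [T1Space X] {f g : C₀(X, ℂ)} {n : ℕ}
    (h0 : ∀ l, ∀ x ∈ accumulationPoints X, f (φ^[n + l] x) * g x = 0)
    (heq : Equicontinuous fun (l : ℕ) (x : X) => f (φ^[n + l] x) * g x) {ε : ℝ} (hε : 0 < ε) :
    {x | ∃ l, ε < ‖f (φ^[n + l] x)‖ ∧ ε < ‖g x‖}.Finite := by
  by_contra hinf
  obtain ⟨x, -, hx⟩ := Set.Infinite.exists_accPt_of_subset_isCompact hinf
    (isCompact_setOf_le_norm g hε) fun x hx => hx.choose_spec.2.le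
  have hxa : x ∈ accumulationPoints X := hx.mono (principal_mono.2 (Set.subset_univ _))
  have hev := Metric.equicontinuousAt_iff_right.1 (heq x) (ε * ε) (by positivity)
  obtain ⟨y, ⟨-, l, hl, hg⟩, hy⟩ := ((accPt_iff_frequently.1 hx).and_eventually hev).exists
  have := hy l
  rw [h0 l x hxa, dist_zero_left, norm_mul] at this
  exact absurd this (not_lt.2 (mul_le_mul hl.le hg.le hε.le (norm_nonneg _)))

/-- Otherwise the orbit clusters at some `y` with `‖f y‖ ≥ ε`. If `y` is not isolated, a visit near
`y` followed by a much later one makes a product of `f` with itself large, against equicontinuity at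
`y`. If `y` is isolated, the orbit hits it twice, so `y` is periodic, hence recurrent, and `f y =
0`. -/
theorem eventually_norm_iterate_le [T2Space X] {f : C₀(X, ℂ)} {m : ℕ}
    (h0 : ∀ l, ∀ x ∈ accumulationPoints X, f (φ^[m + l] x) * f x = 0)
    (hr : ∀ x ∈ recurrentPoints φ, f x = 0)
    (heq : Equicontinuous fun (l : ℕ) (x : X) => f (φ^[m + l] x) * f x) {ε : ℝ} (hε : 0 < ε)
    (x : X) : ∀ᶠ k in atTop, ‖f (φ^[k] x)‖ ≤ ε := by
  by_contra hfreq
  rw [Filter.not_eventually] at hfreq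
  obtain ⟨y, hy, hclus⟩ := (isCompact_setOf_le_norm f hε).exists_mapClusterPt_of_frequently
    (f := fun k => φ^[k] x) (hfreq.mono fun k hk => (not_le.1 hk).le)
  rw [mapClusterPt_iff_frequently] at hclus
  have hfy : f y ≠ 0 := fun h => by
    rw [Set.mem_ofPred_eq, h, norm_zero] at hy
    exact hy.not_gt hε
  by_cases hya : y ∈ accumulationPoints X
  · have hev : ∀ᶠ z in 𝓝 y, ε / 2 < ‖f z‖ :=
      (f.continuous.norm.tendsto y).eventually_const_lt
        ((half_lt_self hε).trans_le (show ε ≤ ‖f y‖ from hy))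
    have heq' := Metric.equicontinuousAt_iff_right.1 (heq y) (ε / 2 * (ε / 2)) (by positivity)
    obtain ⟨k, hk1, hk2⟩ := (hclus _ (hev.and heq')).exists
    obtain ⟨j, hj, hkj⟩ := (frequently_atTop.1 (hclus _ hev)) (m + k)
    have := hk2 (j - (m + k))
    rw [h0 _ y hya, dist_zero_left, norm_mul, ← Function.iterate_add_apply,
      show m + (j - (m + k)) + k = j by omega] at this
    exact absurd this (not_lt.2 (mul_le_mul hkj.le hk1.le (by positivity) (norm_nonneg _)))
  · have hopen : {y} ∈ 𝓝 y := by
      rw [accumulationPoints, mem_derivedSet, AccPt, principal_univ, inf_top_eq,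
        not_neBot, ← isOpen_singleton_iff_punctured_nhds] at hya
      exact hya.mem_nhds rfl
    obtain ⟨k, hk⟩ := (hclus _ hopen).exists
    obtain ⟨j, hj, hkj⟩ := (frequently_atTop.1 (hclus _ hopen)) (k + 1)
    have hper : φ^[j - k] y = y := by
      have hk' : φ^[k] x = y := hk
      have hj' : φ^[j] x = y := hkj
      conv_lhs => rw [← hk', ← Function.iterate_add_apply, show j - k + k = j by omega]
      exact hj'
    refine hfy (hr y ?_)
    by_contra hnr
    exact iterate_ne_of_notMem_recurrentPoints φ hnr (by omega) hper

/-- The hypotheses on the pair `(f, g)` give the finite set; those on `(f, f)` give decay of `f`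
along orbits. Finiteness makes the bound on `l` uniform. -/
theorem isCompactOperator_generator_of_equicontinuous [T2Space X] {f g : C₀(X, ℂ)} {m n : ℕ}
    (h0 : ∀ l, ∀ x ∈ accumulationPoints X, f (φ^[n + l] x) * g x = 0)
    (heq : Equicontinuous fun (l : ℕ) (x : X) => f (φ^[n + l] x) * g x)
    (h0' : ∀ l, ∀ x ∈ accumulationPoints X, f (φ^[m + l] x) * f x = 0)
    (hr : ∀ x ∈ recurrentPoints φ, f x = 0)
    (heq' : Equicontinuous fun (l : ℕ) (x : X) => f (φ^[m + l] x) * f x) :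
    IsCompactOperator fun T => generator φ ρ m f * T * generator φ ρ n g := by
  refine isCompactOperator_generator φ ρ fun ε hε => ?_
  have hF := finite_setOf_lt_norm φ h0 heq hε
  refine ⟨_, hF, ?_⟩
  have hev : ∀ᶠ k in atTop, ∀ x ∈ {x | ∃ l, ε < ‖f (φ^[n + l] x)‖ ∧ ε < ‖g x‖},
      ‖f (φ^[k] x)‖ ≤ ε := by
    rw [Filter.eventually_all_finite hF]
    exact fun x _ => eventually_norm_iterate_le φ h0' hr heq' hε x
  obtain ⟨L, hL⟩ := eventually_atTop.1 hev
  refine ⟨L, fun l x hl hx => ⟨⟨l, hl, hx⟩, ?_⟩⟩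
  by_contra hlL
  exact (hL (n + l) (by omega) x ⟨l, hl, hx⟩).not_gt hl

theorem isCompactElement_of_generator {A : product φ ρ}
    (hgen : ∀ m n, IsCompactOperator fun T =>
      generator φ ρ m (fourierCoeff φ ρ hρ m A) * T *
        generator φ ρ n (fourierCoeff φ ρ hρ n A)) : IsCompactElement A := by
  have hlim := tendsto_cesaroMean φ ρ hρ A
  refine isCompactOperator_mul_mul_of_tendsto hlim hlim fun N => ?_
  exact isCompactElement_sum_smul (Finset.range N) (fun n => ((N - n : ℕ) : ℂ) / N)
    (fun n => generator φ ρ n (fourierCoeff φ ρ hρ n A)) hgen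

theorem isCompactElement_of_fourierCoeff [T2Space X] {A : product φ ρ}
    (h0 : ∀ m n l, ∀ x ∈ accumulationPoints X,
      fourierCoeff φ ρ hρ m A (φ^[n + l] x) * fourierCoeff φ ρ hρ n A x = 0)
    (hr : ∀ m, ∀ x ∈ recurrentPoints φ, fourierCoeff φ ρ hρ m A x = 0)
    (heq : ∀ m n, Equicontinuous fun (l : ℕ) (x : X) =>
      fourierCoeff φ ρ hρ m A (φ^[n + l] x) * fourierCoeff φ ρ hρ n A x) :
    IsCompactElement A :=
  isCompactElement_of_generator φ ρ hρ fun m n => isCompactOperator_generator_of_equicontinuous φ ρ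
    (h0 m n) (heq m n) (h0 m m) (hr m) (heq m m)

end Sufficiency

end Semicrossed

end

theorem corollary2p7
    {X : Type*} [TopologicalSpace X] [LocallyCompactSpace X] [TopologicalSpace.MetrizableSpace X]
    (φ : X ≃ₜ X)
    {H₀ : Type*} [NormedAddCommGroup H₀] [InnerProductSpace ℂ H₀] [CompleteSpace H₀]
    (ρ : C₀(X, ℂ) →⋆ₙₐ[ℂ] (H₀ →L[ℂ] H₀)) (hρ : Function.Injective ρ)
    (A : Semicrossed.product φ ρ) (f : ℕ → C₀(X, ℂ))
    (hf : ∀ m, Semicrossed.fourierCoeff φ ρ hρ m A = f m) :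
    Semicrossed.IsCompactElement A ↔
      ∀ m n : ℕ,
        (∀ l : ℕ, ∀ x ∈ Semicrossed.accumulationPoints X, f m (φ^[n + l] x) * f n x = 0) ∧
        (∀ x ∈ Semicrossed.recurrentPoints φ, f m x = 0) ∧
        Equicontinuous (fun (l : ℕ) (x : X) => f m (φ^[n + l] x) * f n x) := by
  obtain rfl : (fun m => Semicrossed.fourierCoeff φ ρ hρ m A) = f := funext hf
  constructor
  · intro hA m n
    exact ⟨fun l x hx => hA.mul_eq_zero φ ρ hρ hx m n l,
      fun x hx => hA.fourierCoeff_eq_zero φ ρ hρ hx m, hA.equicontinuous φ ρ hρ m n⟩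
  · intro h
    exact Semicrossed.isCompactElement_of_fourierCoeff φ ρ hρ (fun m n => (h m n).1)
      (fun m => (h m m).2.1) fun m n => (h m n).2.2
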